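/- Let $X$ be a connected non-compact $C^\infty$ manifold (Hausdorff, second countable, finite-dimensional, without boundary), for example a connected non-compact Riemannian manifold. Let $\sigma$ be a Borel measure on $X$ that is finite on compact sets, positive on non-empty open sets, satisfies $\sigma(\{x\})=0$ for all $x\in X$, and has $\sigma(X)=\infty$. Let $\Gamma(X)$ be the set of all $\gamma\subset X$ such that $\gamma\cap\Lambda$ is finite for every compact $\Lambda\subset X$; let $\Gamma_0(X)\subset\Gamma(X)$ be the set of finite configurations (including $\varnothing$) and, for $Y\subset X$, let $\Gamma_0(Y)=\{\xi\in\Gamma_0(X):\xi\subset Y\}$. Give $\Gamma_0(X)=\bigsqcup_{n\ge 0}\Gamma^{(n)}$, where $\Gamma^{(n)}$ is the set of $n$-point subsets of $X$, the disjoint union topology, each $\Gamma^{(n)}$ being the quotient by the permutations of coordinates of $\{(x_1,\dots,x_n)\in X^n: x_i\ne x_j \text{ for } i\neq j\}$. Give $\Gamma(X)\setminus\Gamma_0(X)$ the vague topology, i.e. the coarsest one for which all maps $\gamma\mapsto\sum_{x\in\gamma}\varphi(x)$, $\varphi\in C_c^\infty(X)$, are continuous, and give $\Gamma(X)=\Gamma_0(X)\sqcup(\Gamma(X)\setminus\Gamma_0(X))$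 the topology of the disjoint union. Let $\mathcal B(\Gamma_0(X))$ and $\mathcal B(\Gamma(X))$ be the corresponding Borel $\sigma$-algebras. The Lebesgue–Poisson measure is the measure on $\mathcal B(\Gamma_0(X))$ $$\lambda(\alpha)=\sum_{n=0}^\infty\frac1{n!}\,\sigma^{\otimes n}\bigl(\{(x_1,\dots,x_n)\in X^n:\ x_i\ne x_j \text{ for } i\neq j,\ \{x_1,\dots,x_n\}\in\alpha\}\bigr),$$ where the term $n=0$ is $1$ if $\varnothing\in\alpha$ and $0$ otherwise. The Poisson measure $\pi$ with intensity $\sigma$ is the probability measure on $\mathcal B(\Gamma(X))$ such that, for every Borel set $Y\subset X$ with compact closure and every $\alpha\in\mathcal B(\Gamma_0(X))$ with $\alpha\subset\Gamma_0(Y)$, $$\pi(\{\gamma\in\Gamma(X):\ \gamma\cap Y\in\alpha\})=e^{-\sigma(Y)}\lambda(\alpha).$$ Then the Poisson measure of the set of all finite configurations is zero: $\pi(\Gamma_0(X))=0$. -/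

import Mathlib

open Set MeasureTheory
open scoped Manifold ContDiff

noncomputable section

namespace PoissonConfig

/-- The space `Γ(X)` of configurations: the subsets of `X` having finitely many points in each
compact set. -/
def Config (X : Type*) [TopologicalSpace X] : Type _ :=
  {γ : Set X // ∀ K : Set X, IsCompact K → (γ ∩ K).Finite}

/-- The set of finite configurations (the empty one included), as a subset of `Γ(X)`. -/
def finiteConfigs (X : Type*) [TopologicalSpace X] : Set (Config X) :=
  {γ | γ.1.Finite}

/-- The space `Γ₀(X)` of finite configurations. -/
def FinConfig (X : Type*) [TopologicalSpace X] : Type _ :=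
  {γ : Config X // γ ∈ finiteConfigs X}

/-- The points of `Xⁿ` with pairwise different coordinates. -/
abbrev DistinctTuple (X : Type*) (n : ℕ) : Type _ :=
  {x : Fin n → X // Function.Injective x}

/-- The `n`-point configuration `[x₁, …, xₙ]` of a tuple with pairwise different coordinates. -/
def ofTuple {X : Type*} [TopologicalSpace X] (n : ℕ) (x : DistinctTuple X n) : FinConfig X :=
  ⟨⟨range x.1, fun K _ => (finite_range x.1).subset (inter_subset_left (t := K))⟩,
    finite_range x.1⟩

/-- The ordinary topology on `Γ₀(X) = ⨆ₙ Γ⁽ⁿ⁾`: the topology of the disjoint union of the spaces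
`Γ⁽ⁿ⁾`, each being the quotient, by permutations of the coordinates, of the subspace of `Xⁿ` of
points with different coordinates. A set is open if and only if its preimages under all the maps
`ofTuple n` are open. -/
instance ordinaryTopology (X : Type*) [TopologicalSpace X] : TopologicalSpace (FinConfig X) :=
  ⨆ n : ℕ, TopologicalSpace.coinduced (ofTuple (X := X) n) inferInstance

/-- The Borel `σ`-algebra of `Γ₀(X)`, for the ordinary topology. -/
instance finBorel (X : Type*) [TopologicalSpace X] : MeasurableSpace (FinConfig X) :=
  borel (FinConfig X)

section Topology

variable {E : Type*} [NormedAddCommGroup E] [NormedSpace ℝ E]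
  {H : Type*} [TopologicalSpace H] (I : ModelWithCorners ℝ E H)
  (X : Type*) [TopologicalSpace X] [ChartedSpace H X]

/-- The space `𝒟` of real smooth functions on `X` with compact support. -/
def TestFun : Type _ :=
  {f : X → ℝ // ContMDiff I 𝓘(ℝ, ℝ) ∞ f ∧ HasCompactSupport f}

/-- The pairing `⟨γ, φ⟩ = ∑_{x ∈ γ} φ(x)` (only finitely many terms are different from zero). -/
def pairing (φ : TestFun I X) (γ : Config X) : ℝ :=
  ∑ᶠ x ∈ γ.1, φ.1 x

/-- The vague topology on `Γ(X)`: the one induced by the weak topology of `𝒟'` through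
`γ ↦ ⟨γ, ·⟩`, that is, the coarsest topology for which all the maps `γ ↦ ⟨γ, φ⟩`, `φ ∈ 𝒟`, are
continuous. -/
abbrev vagueTopology : TopologicalSpace (Config X) :=
  ⨅ φ : TestFun I X, TopologicalSpace.induced (pairing I X φ) inferInstance

/-- The ordinary-vague topology on `Γ(X)`: the topology of the disjoint union of `Γ₀(X)`, with its
ordinary topology, and of its complement, with the relative vague topology. -/
abbrev ordinaryVagueTopology : TopologicalSpace (Config X) :=
  TopologicalSpace.coinduced (fun ξ : FinConfig X => ξ.1) (ordinaryTopology X) ⊔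
    TopologicalSpace.coinduced
      (Subtype.val : {γ : Config X // γ ∉ finiteConfigs X} → Config X)
      (TopologicalSpace.induced Subtype.val (vagueTopology I X))

/-- The Borel `σ`-algebra of `Γ(X)`, for the ordinary-vague topology. -/
abbrev configBorel : MeasurableSpace (Config X) :=
  @borel (Config X) (ordinaryVagueTopology I X)

end Topology

/-- The Lebesgue–Poisson measure `λ = ∑ₙ (1/n!) σ⁽ⁿ⁾` on `Γ₀(X)`: here `σ⁽ⁿ⁾` is the `n`-fold product
measure, restricted to the points with different coordinates and carried to the `n`-point
configurations; for `n = 0` it is the unit mass at the empty configuration. -/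
def lebesguePoisson {X : Type*} [TopologicalSpace X] [MeasurableSpace X] (σ : Measure X) :
    Measure (FinConfig X) :=
  Measure.sum fun n : ℕ =>
    ((n.factorial : ENNReal)⁻¹) •
      Measure.map (ofTuple n)
        (Measure.comap (Subtype.val : DistinctTuple X n → (Fin n → X))
          (Measure.pi fun _ : Fin n => σ))

/-- The set `Γ₀(Y)` of the finite configurations that are contained in `Y`. -/
def finWithin {X : Type*} [TopologicalSpace X] (Y : Set X) : Set (FinConfig X) :=
  {ξ | ξ.1.1 ⊆ Y}

/-- The projection `p_Y : γ ↦ γ ∩ Y`, for a set `Y` with compact closure. -/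
def proj {X : Type*} [TopologicalSpace X] (Y : Set X) (hY : IsCompact (closure Y))
    (γ : Config X) : FinConfig X :=
  ⟨⟨γ.1 ∩ Y, fun K hK => (γ.2 K hK).subset (inter_subset_inter_left K inter_subset_left)⟩,
    (γ.2 (closure Y) hY).subset (inter_subset_inter_right γ.1 subset_closure)⟩

/-- `π` is the Poisson measure with intensity `σ`: it is a probability measure on the Borel
`σ`-algebra of `Γ(X)`, and for every Borel set `Y` with compact closure its image under `p_Y` is the
measure `e^{-σ(Y)} λ` on `Γ₀(Y)`. -/
structure IsPoissonMeasure {E : Type*} [NormedAddCommGroup E] [NormedSpace ℝ E]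
    {H : Type*} [TopologicalSpace H] (I : ModelWithCorners ℝ E H)
    {X : Type*} [TopologicalSpace X] [ChartedSpace H X] [MeasurableSpace X]
    (σ : Measure X) (π : @Measure (Config X) (configBorel I X)) : Prop where
  isProbabilityMeasure : IsProbabilityMeasure π
  proj_preimage : ∀ (Y : Set X) (hY : IsCompact (closure Y)), MeasurableSet Y →
    ∀ α : Set (FinConfig X), MeasurableSet α → α ⊆ finWithin Y →
      π (proj Y hY ⁻¹' α) = ENNReal.ofReal (Real.exp (-(σ Y).toReal)) * lebesguePoisson σ α

end PoissonConfig

end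

/-! A finite configuration lies in one member of a countable exhaustion by compact sets, so it
suffices that, for each compact `K`, almost no configuration lies inside `K`. Such a configuration
misses every `Y m = compactCovering X m \ K`. Since `λ({∅}) = 1`, the defining property of `π` with
`α = {∅}` gives the void probability `exp(-σ(Y m))`. This tends to `0`, because `σ(Y m)` increases
to `σ(X \ K) = ∞`. -/

namespace PoissonConfig

section LebesguePoisson

variable {X : Type*} [TopologicalSpace X]

/-- The empty configuration. -/
def emptyFin (X : Type*) [TopologicalSpace X] : FinConfig X :=
  ⟨⟨∅, fun K _ => by simp⟩, finite_empty⟩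

theorem ofTuple_zero (x : DistinctTuple X 0) : ofTuple 0 x = emptyFin X :=
  Subtype.ext (Subtype.ext (range_eq_empty x.1))

theorem ofTuple_succ_ne_emptyFin (n : ℕ) (x : DistinctTuple X (n + 1)) :
    ofTuple (n + 1) x ≠ emptyFin X := fun h =>
  (range_nonempty x.1).ne_empty (congrArg (fun ξ : FinConfig X => ξ.1.1) h)

theorem preimage_ofTuple_succ_emptyFin (n : ℕ) :
    ofTuple (n + 1) ⁻¹' {emptyFin X} = ∅ :=
  eq_empty_of_forall_notMem fun x => ofTuple_succ_ne_emptyFin n x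

theorem preimage_ofTuple_zero_emptyFin : ofTuple 0 ⁻¹' {emptyFin X} = univ :=
  eq_univ_of_forall ofTuple_zero

/-- Emptiness is decided by the number of points, so `∅` is isolated. This makes `{∅}` an admissible
`α` in `proj_preimage`. -/
theorem isOpen_singleton_emptyFin : IsOpen {emptyFin X} := by
  refine isOpen_iSup_iff.2 fun n => isOpen_coinduced.2 ?_
  cases n with
  | zero => rw [preimage_ofTuple_zero_emptyFin]; exact isOpen_univ
  | succ n => rw [preimage_ofTuple_succ_emptyFin]; exact isOpen_empty

theorem measurableSet_singleton_emptyFin : MeasurableSet {emptyFin X} :=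
  MeasurableSpace.measurableSet_generateFrom isOpen_singleton_emptyFin

theorem continuous_ofTuple (n : ℕ) : Continuous (ofTuple (X := X) n) :=
  continuous_iff_coinduced_le.2 (le_iSup_iff.2 fun _ h => h n)

theorem finiteConfigs_subset_iUnion [SigmaCompactSpace X] :
    finiteConfigs X ⊆ ⋃ m : ℕ, {γ : Config X | γ.1 ⊆ compactCovering X m} := by
  intro γ hγ
  have hdir : Directed (· ⊆ ·) (compactCovering X) :=
    Monotone.directed_le fun _ _ h => compactCovering_subset X h
  obtain ⟨m, hm⟩ := hdir.exists_mem_subset_of_finset_subset_biUnion (s := Set.Finite.toFinset hγ)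
    (by rw [iUnion_compactCovering]; exact subset_univ _)
  exact mem_iUnion.2 ⟨m, (Set.Finite.coe_toFinset hγ).symm.subset.trans hm⟩

variable [MeasurableSpace X]

/-- Second countability makes the product `σ`-algebra on `Xⁿ` Borel, so continuity suffices. Without
measurability `Measure.map` could take its default value `0`. -/
theorem measurable_ofTuple [BorelSpace X] [SecondCountableTopology X] (n : ℕ) :
    Measurable (ofTuple (X := X) n) :=
  haveI : BorelSpace (FinConfig X) := ⟨rfl⟩
  (continuous_ofTuple n).measurable

theorem lebesguePoisson_singleton_emptyFin [BorelSpace X] [SecondCountableTopology X]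
    (σ : Measure X) [SigmaFinite σ] : lebesguePoisson σ {emptyFin X} = 1 := by
  have h : MeasurableSet {emptyFin X} := measurableSet_singleton_emptyFin
  rw [lebesguePoisson, Measure.sum_apply _ h, tsum_eq_single 0]
  · rw [Measure.smul_apply, Measure.map_apply (measurable_ofTuple 0) h,
      preimage_ofTuple_zero_emptyFin,
      -- `X⁰` is a single point, so images under the inclusion are trivially measurable.
      Measure.comap_apply _ Subtype.val_injective
        (fun s _ => (Set.subsingleton_of_subsingleton).measurableSet) _ MeasurableSet.univ]
    have : (Subtype.val '' (univ : Set (DistinctTuple X 0))) = univ :=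
      eq_univ_of_forall fun x => ⟨⟨x, Function.injective_of_subsingleton x⟩, trivial, rfl⟩
    rw [this, Measure.pi_univ]
    simp
  · intro n hn
    obtain ⟨n, rfl⟩ := Nat.exists_eq_succ_of_ne_zero hn
    rw [Measure.smul_apply, Measure.map_apply (measurable_ofTuple _) h,
      Nat.succ_eq_add_one, preimage_ofTuple_succ_emptyFin, measure_empty, smul_zero]

end LebesguePoisson

section Poisson

open Filter Topology

variable {E : Type*} [NormedAddCommGroup E] [NormedSpace ℝ E]
  {H : Type*} [TopologicalSpace H] {I : ModelWithCorners ℝ E H}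
  {X : Type*} [TopologicalSpace X] [ChartedSpace H X] [MeasurableSpace X] [BorelSpace X]
  [SecondCountableTopology X] {σ : Measure X} {π : @Measure (Config X) (configBorel I X)}

/-- The void probability of `Y` bounds the measure of the configurations not meeting `Y`. -/
theorem IsPoissonMeasure.measure_disjoint_le [SigmaFinite σ] (hπ : IsPoissonMeasure I σ π) {Y : Set X}
    (hY : IsCompact (closure Y)) (hm : MeasurableSet Y) :
    π {γ : Config X | Disjoint γ.1 Y} ≤ ENNReal.ofReal (Real.exp (-(σ Y).toReal)) := by
  have h := hπ.proj_preimage Y hY hm {emptyFin X} measurableSet_singleton_emptyFin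
    (singleton_subset_iff.2 (empty_subset Y))
  rw [lebesguePoisson_singleton_emptyFin, mul_one] at h
  rw [← h]
  -- Monotonicity needs no measurability of the void event.
  exact measure_mono fun γ hγ =>
    Subtype.ext (Subtype.ext (disjoint_iff_inter_eq_empty.1 hγ))

/-- If `K` is compact and `σ` is infinite, almost no configuration is contained in `K`. -/
theorem IsPoissonMeasure.measure_subset_compact [T2Space X] [SigmaCompactSpace X]
    [IsFiniteMeasureOnCompacts σ] (hσ : σ univ = ⊤) (hπ : IsPoissonMeasure I σ π)
    {K : Set X} (hK : IsCompact K) : π {γ : Config X | γ.1 ⊆ K} = 0 := by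
  let Y : ℕ → Set X := fun m => compactCovering X m \ K
  have hYc (m : ℕ) : IsCompact (closure (Y m)) :=
    (isCompact_compactCovering X m).closure_of_subset sdiff_subset
  have hYm (m : ℕ) : MeasurableSet (Y m) :=
    (isCompact_compactCovering X m).measurableSet.diff hK.measurableSet
  have hmono : Monotone Y := fun m n h =>
    sdiff_subset_sdiff_left (compactCovering_subset X h)
  have hunion : ⋃ m, Y m = univ \ K := by
    rw [← iUnion_sdiff, iUnion_compactCovering]
  have htop : σ (univ \ K) = ⊤ := by
    rw [measure_sdiff (subset_univ K) hK.measurableSet.nullMeasurableSet hK.measure_ne_top, hσ,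
      ENNReal.top_sub hK.measure_ne_top]
  have hlim : Tendsto (fun m => σ (Y m)) atTop (𝓝 ⊤) := by
    rw [← htop, ← hunion]
    exact tendsto_measure_iUnion_atTop hmono
  have hreal : Tendsto (fun m => (σ (Y m)).toReal) atTop atTop := by
    -- `toReal` sends `⊤` to `0`, so each `σ (Y m)` must be finite; compactness of the closure
    -- ensures it.
    refine ENNReal.tendsto_ofReal_nhds_top.1 (hlim.congr fun m => ?_)
    exact (ENNReal.ofReal_toReal
      ((measure_mono subset_closure).trans_lt (hYc m).measure_lt_top).ne).symm
  have hexp : Tendsto (fun m => ENNReal.ofReal (Real.exp (-(σ (Y m)).toReal))) atTop (𝓝 0) := by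
    rw [← ENNReal.ofReal_zero]
    exact ENNReal.tendsto_ofReal (Real.tendsto_exp_neg_atTop_nhds_zero.comp hreal)
  refine le_antisymm (ge_of_tendsto' hexp fun m => ?_) bot_le
  exact (measure_mono fun γ hγ => disjoint_sdiff_right.mono_left hγ).trans
    (hπ.measure_disjoint_le (hYc m) (hYm m))

end Poisson

end PoissonConfig

theorem mainTheorem4
    {E : Type*} [NormedAddCommGroup E] [NormedSpace ℝ E] [FiniteDimensional ℝ E]
    {H : Type*} [TopologicalSpace H] (I : ModelWithCorners ℝ E H) [I.Boundaryless]
    {X : Type*} [TopologicalSpace X] [ChartedSpace H X] [IsManifold I ∞ X]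
    [T2Space X] [SecondCountableTopology X] [ConnectedSpace X] [NoncompactSpace X]
    [MeasurableSpace X] [BorelSpace X]
    (σ : Measure X) [IsFiniteMeasureOnCompacts σ] [σ.IsOpenPosMeasure] [NullSingletonClass σ]
    (hσ : σ Set.univ = ⊤)
    (π : @Measure (PoissonConfig.Config X) (PoissonConfig.configBorel I X))
    (hπ : PoissonConfig.IsPoissonMeasure I σ π) :
    π (PoissonConfig.finiteConfigs X) = 0 := by
  -- With second countability this gives `σ`-compactness, hence the exhaustion.
  have : LocallyCompactSpace X := Manifold.locallyCompact_of_finiteDimensional I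
  exact measure_mono_null PoissonConfig.finiteConfigs_subset_iUnion
    (measure_iUnion_null fun m =>
      hπ.measure_subset_compact hσ (isCompact_compactCovering X m))
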